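/- Setting. For probability measures $P,Q$ on a measurable space let $T(P,Q)(\alpha)=\inf\{1-\mathbb E_Q g : g \text{ measurable},\ 0\le g\le 1,\ \mathbb E_P g\le 1-\alpha\}$, $\alpha\in[0,1]$. A tradeoff function is a convex, continuous, nondecreasing $f:[0,1]\to[0,1]$ with $f(x)\le x$; it is symmetric if $f=T(P,Q)$ implies $f=T(Q,P)$, and nontrivial if $f(\alpha)<\alpha$ for some $\alpha\in(0,1)$. For a set $\mathcal D$ of databases and a relation $A$ on $\mathcal D$, a mechanism $M$ is $(\mathcal D,A,f)$-DP if $T(M(X),M(X'))\ge f$ for all $X,X'\in\mathcal D$ with $A(X,X')$. A continuous distribution function $F$ is a canonical noise distribution (CND) for $f$ if $T(F(\cdot),F(\cdot-m))\ge f$ for all $m\in[0,1]$; $f(\alpha)=T(F(\cdot),F(\cdot-1))(\alpha)=F(F^{-1}(\alpha)-1)$ for all $\alpha\in(0,1)$, with $F^{-1}(\alpha)=\inf\{x:F(x)\ge\alpha\}$; and $F(x)=1-F(-x)$ for all $x$. A database $X=(X_1,\dots,X_n)\in(\{1,2\}^2)^n$ has the $2\times2$ table $(x_{11},x_{12},x_{21},x_{22})$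 of counts and the one-way margins $t=(t_{1\cdot},t_{2\cdot},t_{\cdot1},t_{\cdot2})$. Fix the margins $t$ of some database, let $\mathcal D_t$ be the set of databases with margins $t$, $\mathcal D_t^i=\{X_i:X\in\mathcal D_t\}$, $d$ the Hamming distance, $a(t)=\sup_i\sup_{x,y\in\mathcal D_t^i}\inf\{d(X,Y):X,Y\in\mathcal D_t,\ X_i=x,\ Y_i=y\}$ and $A_{a(t)}(X,X')\iff d(X,X')\le a(t)$. For $w>0$ let $\mathrm{Hyper}(w)=\mathrm{Hyper}(t_{1\cdot},t_{2\cdot},t_{\cdot1},w)$ be the law on $x\in\{\max(0,t_{\cdot1}-t_{2\cdot}),\dots,\min(t_{1\cdot},t_{\cdot1})\}$ with mass proportional to $\binom{t_{1\cdot}}{x}\binom{t_{2\cdot}}{t_{\cdot1}-x}w^x$. A test is a $[0,1]$-valued function $\phi$ of the table (the probability of rejecting); it is DP if the mechanism $\mathrm{Bern}(\phi(X))$ is. Its power at $w$ is $\mathbb E_w\phi=\mathbb E_{H\sim\mathrm{Hyper}(w)}\phi(H,t_{1\cdot}-H,t_{\cdot1}-H,H+t_{2\cdot}-t_{\cdot1})$.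 For $\alpha\in(0,1)$ let $\Phi$ be the set of tests $\phi$ that are $(\mathcal D_t,A_{a(t)},f)$-DP and satisfy $\mathbb E_1\phi=\alpha$. Theorem. Let $f$ be a symmetric nontrivial tradeoff function, $F$ a CND for $f$, and $\alpha\in(0,1)$. 1. If $x_{11}\sim\mathrm{Binom}(t_{1\cdot},\theta_1)$ and $x_{21}\sim\mathrm{Binom}(t_{2\cdot},\theta_2)$ are independent, $\theta_1,\theta_2\in(0,1)$, then given $x_{11}+x_{21}=t_{\cdot1}$ the count $x_{11}$ has law $\mathrm{Hyper}(w)$, where $w=\frac{\theta_1/(1-\theta_1)}{\theta_2/(1-\theta_2)}$ is the odds ratio. 2. There is $m=m(t)\in\mathbb R$ with $\mathbb E_{H\sim\mathrm{Hyper}(1)}F(H-m)=\alpha$. For every such $m$ the test $\phi^*(X)=F(x_{11}-m)$ is UMP among $\Phi$ for $H_0:w\le1$ versus $H_1:w>1$: $\phi^*\in\Phi$, its size $\sup_{0<w\le1}\mathbb E_w\phi^*$ is $\alpha$, and $\mathbb E_w\phi\le\mathbb E_w\phi^*$ for all $\phi\in\Phi$ and all $w>1$. 3. If $N\sim F$,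 then $U=x_{11}+N$ is $(\mathcal D_t,A_{a(t)},f)$-DP. 4. The quantity $p=p(U)=\mathbb E_{H\sim\mathrm{Hyper}(1)}F(H-U)$, a measurable function of $U$ and $t$, is a $p$-value: if $x_{11}\sim\mathrm{Hyper}(w)$ with $0<w\le1$ and $N\sim F$ are independent, then $\mathbb P(p\le a)\le a$ for all $a\in[0,1]$. It agrees with $\phi^*$: for every $X\in\mathcal D_t$, $\mathbb P(p\le\alpha\mid X)=\phi^*(X)$. -/

import Mathlib

open MeasureTheory ProbabilityTheory

namespace SemiDP

noncomputable section

/-! ### Tradeoff functions, `f`-differential privacy, canonical noise -/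

/-- The tradeoff function `T(P, Q)`, in the convention where the type I error is `1 - α`. -/
def tradeoff {Y : Type*} [MeasurableSpace Y] (P Q : Measure Y) (α : ℝ) : ℝ :=
  sInf {b : ℝ | ∃ g : Y → ℝ, Measurable g ∧ (∀ y, 0 ≤ g y ∧ g y ≤ 1) ∧
    ∫ y, g y ∂P ≤ 1 - α ∧ b = 1 - ∫ y, g y ∂Q}

/-- `f : [0,1] → [0,1]` is a tradeoff function: convex, continuous, nondecreasing, `f x ≤ x`.
Values of `f` outside `[0,1]` are irrelevant. -/
structure IsTradeoffFunction (f : ℝ → ℝ) : Prop where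
  convex : ConvexOn ℝ (Set.Icc 0 1) f
  continuous : ContinuousOn f (Set.Icc 0 1)
  monotone : MonotoneOn f (Set.Icc 0 1)
  nonneg : ∀ x ∈ Set.Icc (0 : ℝ) 1, 0 ≤ f x
  le_self : ∀ x ∈ Set.Icc (0 : ℝ) 1, f x ≤ x

/-- `f` is symmetric: if `f = T(P, Q)` then `f = T(Q, P)`. -/
def IsSymmetricTradeoff (f : ℝ → ℝ) : Prop :=
  ∀ (Y : Type) [MeasurableSpace Y] (P Q : Measure Y)
    [IsProbabilityMeasure P] [IsProbabilityMeasure Q],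
    (∀ α ∈ Set.Icc (0 : ℝ) 1, f α = tradeoff P Q α) →
      ∀ α ∈ Set.Icc (0 : ℝ) 1, f α = tradeoff Q P α

/-- `f` is nontrivial: `f α < α` for some `α ∈ (0,1)`. -/
def IsNontrivialTradeoff (f : ℝ → ℝ) : Prop :=
  ∃ α ∈ Set.Ioo (0 : ℝ) 1, f α < α

/-- `(S, A, f)`-DP of the mechanism `M`: `T(M X, M X') ≥ f` for all `A`-adjacent `X, X' ∈ S`.
`M X` is the law of the output on the database `X`. -/
def IsDP {D Y : Type*} [MeasurableSpace Y] (S : Set D) (A : D → D → Prop) (f : ℝ → ℝ)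
    (M : D → Measure Y) : Prop :=
  ∀ X ∈ S, ∀ X' ∈ S, A X X' → ∀ α ∈ Set.Icc (0 : ℝ) 1, f α ≤ tradeoff (M X) (M X') α

/-- The quantile function `F⁻¹` of the distribution function `F` of `ν`. -/
def quantile (ν : Measure ℝ) (α : ℝ) : ℝ :=
  sInf {x : ℝ | α ≤ cdf ν x}

/-- The distribution function `F = cdf ν` of `ν` is a canonical noise distribution for `f`.
`ν.map (· + m)` is the law with distribution function `F(· - m)`. -/
structure IsCND (f : ℝ → ℝ) (ν : Measure ℝ) : Prop where
  continuous : Continuous (fun x => cdf ν x)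
  dp : ∀ m ∈ Set.Icc (0 : ℝ) 1, ∀ α ∈ Set.Icc (0 : ℝ) 1,
    f α ≤ tradeoff ν (ν.map (fun z => z + m)) α
  tight : ∀ α ∈ Set.Ioo (0 : ℝ) 1, f α = tradeoff ν (ν.map (fun z => z + 1)) α
  threshold : ∀ α ∈ Set.Ioo (0 : ℝ) 1,
    tradeoff ν (ν.map (fun z => z + 1)) α = cdf ν (quantile ν α - 1)
  symm : ∀ x : ℝ, cdf ν x = 1 - cdf ν (-x)

/-! ### Databases, tables, margins, semi-adjacency -/

/-- `n` individuals with two binary features; the levels `1, 2` are the elements `0, 1`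
of `Fin 2`. -/
abbrev Database (n : ℕ) : Type := Fin n → Fin 2 × Fin 2

/-- `2 × 2` tables of counts. -/
abbrev Table : Type := Fin 2 → Fin 2 → ℕ

/-- One-way margins: `t.1 = (t₁., t₂.)` are the row totals, `t.2 = (t.₁, t.₂)` the column
totals. -/
abbrev Margins : Type := (Fin 2 → ℕ) × (Fin 2 → ℕ)

/-- The contingency table of a database. -/
def table {n : ℕ} (X : Database n) : Table :=
  fun i j => (Finset.univ.filter (fun k => X k = (i, j))).card

/-- The one-way margins of a database. -/
def margins {n : ℕ} (X : Database n) : Margins :=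
  (fun i => (Finset.univ.filter (fun k => (X k).1 = i)).card,
   fun j => (Finset.univ.filter (fun k => (X k).2 = j)).card)

/-- The invariant-conforming databases `D_t`. -/
def conforming (n : ℕ) (t : Margins) : Set (Database n) :=
  {X | margins X = t}

/-- The possible values `D^i` of the record of individual `i` over the databases in `D`. -/
def records {n : ℕ} (D : Set (Database n)) (i : Fin n) : Set (Fin 2 × Fin 2) :=
  {x | ∃ X ∈ D, X i = x}

/-- The semi-adjacent parameter of `D` with respect to the Hamming distance. -/
def semiAdjParam {n : ℕ} (D : Set (Database n)) : ℕ∞ :=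
  ⨆ (i : Fin n) (x ∈ records D i) (y ∈ records D i),
    ⨅ (X : Database n) (Y : Database n) (_ : X ∈ D ∧ Y ∈ D ∧ X i = x ∧ Y i = y),
      (hammingDist X Y : ℕ∞)

/-- The adjacency `A_a`: Hamming distance at most `a`. -/
def hammingAdj {n : ℕ} (a : ℕ∞) (X X' : Database n) : Prop :=
  (hammingDist X X' : ℕ∞) ≤ a

/-- `(D_t, A_{a(t)}, f)`-DP of a mechanism. -/
def IsSemiDP {n : ℕ} {Y : Type*} [MeasurableSpace Y] (t : Margins) (f : ℝ → ℝ)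
    (M : Database n → Measure Y) : Prop :=
  IsDP (conforming n t) (hammingAdj (semiAdjParam (conforming n t))) f M

/-! ### Fisher's noncentral hypergeometric law and tests -/

/-- The odds ratio of the success probabilities `θ₁` (row 1) and `θ₂` (row 2). -/
def oddsRatio (θ₁ θ₂ : ℝ) : ℝ :=
  (θ₁ / (1 - θ₁)) / (θ₂ / (1 - θ₂))

/-- The support `L, …, U` of the hypergeometric law with margins `t`; truncated subtraction
gives `L = max 0 (t.₁ - t₂.)`. -/
def hyperSupport (t : Margins) : Finset ℕ :=
  Finset.Icc (t.2 0 - t.1 1) (min (t.1 0) (t.2 0))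

/-- Unnormalized mass `C(t₁., x) C(t₂., t.₁ - x) w ^ x`. -/
def hyperWeight (t : Margins) (w : ℝ) (x : ℕ) : ℝ :=
  ((t.1 0).choose x : ℝ) * ((t.1 1).choose (t.2 0 - x) : ℝ) * w ^ x

/-- Fisher's noncentral hypergeometric law `Hyper(t₁., t₂., t.₁, w)` of the count `x₁₁`. -/
def hyperLaw (t : Margins) (w : ℝ) : Measure ℕ :=
  ∑ x ∈ hyperSupport t,
    ENNReal.ofReal (hyperWeight t w x / ∑ k ∈ hyperSupport t, hyperWeight t w k) •
      Measure.dirac x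

/-- The joint law of `(x₁₁, x₂₁)` given the row totals: independent `Binom(t₁., θ₁)` and
`Binom(t₂., θ₂)`. -/
def twoBinomial (t : Margins) (θ₁ θ₂ : unitInterval) : Measure (ℕ × ℕ) :=
  (binomial (t.1 0) θ₁).prod (binomial (t.1 1) θ₂)

/-- The conditional law of `x₁₁` given that the first column total equals `t.₁`. -/
def conditionalLaw (t : Margins) (θ₁ θ₂ : unitInterval) : Measure ℕ :=
  (ProbabilityTheory.cond (twoBinomial t θ₁ θ₂) {q | q.1 + q.2 = t.2 0}).map Prod.fst

/-- The table `(h, t₁. - h, t.₁ - h, h + t₂. - t.₁)`; for `h` in the support the subtractions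
are exact. -/
def tableOf (t : Margins) (h : ℕ) : Table :=
  ![![h, t.1 0 - h], ![t.2 0 - h, h + t.1 1 - t.2 0]]

/-- A test: `φ x` is the probability of rejecting the null hypothesis given the table `x`. -/
abbrev TableTest : Type := Table → unitInterval

/-- The power function `w ↦ 𝔼_w φ` given the margins `t`. -/
def power (t : Margins) (φ : TableTest) (w : ℝ) : ℝ :=
  ∫ h, (φ (tableOf t h) : ℝ) ∂(hyperLaw t w)

/-- The mechanism releasing a `Bern(φ X)` draw (`true` is "reject"). -/
def testMechanism (n : ℕ) (φ : TableTest) : Database n → Measure Bool :=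
  fun X => bernoulliMeasure true false (φ (table X))

/-- The `(D_t, A_{a(t)}, f)`-DP tests with Neyman structure: expectation `α` at odds ratio `1`
given the margins. -/
def semiDPTests (n : ℕ) (t : Margins) (f : ℝ → ℝ) (α : ℝ) : Set TableTest :=
  {φ | IsSemiDP t f (testMechanism n φ) ∧ power t φ 1 = α}

/-- `φ` is UMP of size `α` among the tests in `Φ` for `H₀ : w ∈ Ω₀` versus `H₁ : w ∈ Ω₁`. -/
def IsUMP (t : Margins) (Φ : Set TableTest) (Ω₀ Ω₁ : Set ℝ) (α : ℝ) (φ : TableTest) : Prop :=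
  φ ∈ Φ ∧ IsLUB (power t φ '' Ω₀) α ∧ ∀ ψ ∈ Φ, ∀ w ∈ Ω₁, power t ψ w ≤ power t φ w

/-- The test `x ↦ F(x₁₁ - m)`, `F = cdf ν`. -/
def noiseTest (ν : Measure ℝ) (m : ℝ) : TableTest :=
  fun x => ⟨cdf ν ((x 0 0 : ℝ) - m), cdf_nonneg ν _, cdf_le_one ν _⟩

/-- The mechanism releasing `U = x₁₁ + N`, `N ∼ ν`. -/
def noisyCount (n : ℕ) (ν : Measure ℝ) : Database n → Measure ℝ :=
  fun X => ν.map (fun z => (table X 0 0 : ℝ) + z)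

/-- The quantity `p = 𝔼_{H ∼ Hyper(t₁., t₂., t.₁, 1)} F(H - u)` as a function of the released
value `u` and the invariant `t`. -/
def pValue (t : Margins) (ν : Measure ℝ) (u : ℝ) : ℝ :=
  ∫ h, cdf ν ((h : ℝ) - u) ∂(hyperLaw t 1)

end

end SemiDP

/-! The privacy constraint reduces to a one-dimensional one. With both margins fixed, the table is
determined by `x₁₁`. Changing a single record breaks a margin, while any feasible record can be
installed by exchanging features with one other individual. So `a(t) ≤ 2`, with equality as soon as
two conforming databases exist. Adjacent databases then have counts `x₁₁` at distance at most one,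
and every two neighbouring points of the hypergeometric support come from adjacent databases
(`table_le_of_adjacent`, `exists_adjacent`). The first fact makes `x₁₁ + N` private, and
thresholding it at `m` gives the noise test. The second forces every private test to satisfy `φ(x +
1) ≤ 1 - f (1 - φ(x))`.

Optimality is a single-crossing argument. Where `0 < F(x - m) < 1`, canonical noise grows as fast as
that recursion allows, because `F(c - 1) ≤ f (F c)` (`IsCND.cdf_sub_one_le`). As `f` is monotone, a
private test that has fallen below the noise test stays below it (`IsCND.exists_crossing`). The two
tests have the same mean at `w = 1`, and passing to `w > 1` tilts the weights by the increasing
factor `w ^ x`, which favours the test that is larger on the right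
(`integral_hyperLaw_of_crossing`).

The `p`-value at `u` is the null power of the noise test with threshold `u`, which is continuous and
decreasing in `u`. For `a < 1`, the event `p ≤ a` is thus empty or of the form `U ≥ u₀` with `p(u₀)
≤ a`. Its probability at `w = 1` is `p(u₀)`, and it is no larger for `w < 1`. -/

namespace SemiDP

/-! ### The hypergeometric law -/

/-- Normalized mass of the noncentral hypergeometric law. -/
noncomputable def hyperMass (t : Margins) (w : ℝ) (x : ℕ) : ℝ :=
  hyperWeight t w x / ∑ k ∈ hyperSupport t, hyperWeight t w k

/-- The hypergeometric support is nonempty. -/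
def Feasible (t : Margins) : Prop := (hyperSupport t).Nonempty

lemma hyperWeight_pos {t : Margins} {w : ℝ} (hw : 0 < w) {x : ℕ} (hx : x ∈ hyperSupport t) :
    0 < hyperWeight t w x := by
  simp only [hyperSupport, Finset.mem_Icc, le_min_iff] at hx
  unfold hyperWeight
  have h1 : 0 < (t.1 0).choose x := Nat.choose_pos hx.2.1
  have h2 : 0 < (t.1 1).choose (t.2 0 - x) := Nat.choose_pos (by omega)
  positivity

lemma sum_hyperWeight_pos {t : Margins} (ht : Feasible t) {w : ℝ} (hw : 0 < w) :
    0 < ∑ k ∈ hyperSupport t, hyperWeight t w k :=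
  Finset.sum_pos (fun _ hk => hyperWeight_pos hw hk) ht

lemma hyperMass_pos {t : Margins} {w : ℝ} (hw : 0 < w) {x : ℕ} (hx : x ∈ hyperSupport t) :
    0 < hyperMass t w x :=
  div_pos (hyperWeight_pos hw hx) (sum_hyperWeight_pos ⟨x, hx⟩ hw)

lemma sum_hyperMass {t : Margins} (ht : Feasible t) {w : ℝ} (hw : 0 < w) :
    ∑ k ∈ hyperSupport t, hyperMass t w k = 1 := by
  simp only [hyperMass]
  rw [← Finset.sum_div, div_self (sum_hyperWeight_pos ht hw).ne']

lemma integral_hyperLaw (t : Margins) {w : ℝ} (hw : 0 < w) (g : ℕ → ℝ) :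
    ∫ h, g h ∂(hyperLaw t w) = ∑ k ∈ hyperSupport t, hyperMass t w k * g k := by
  unfold hyperLaw
  rw [integral_finsetSum_measure]
  · refine Finset.sum_congr rfl fun k hk => ?_
    rw [integral_smul_measure, integral_dirac, ENNReal.toReal_ofReal, smul_eq_mul, hyperMass]
    exact (hyperMass_pos hw hk).le
  · intro k _
    exact (integrable_dirac (by simp)).smul_measure ENNReal.ofReal_ne_top

/-- Two expectations that agree at odds ratio `1` are ordered at other odds ratios, if the
integrands cross once. -/
lemma sum_tilt_of_crossing {S : Finset ℕ} {c h : ℕ → ℝ} (hc : ∀ k ∈ S, 0 ≤ c k) (x₀ : ℕ)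
    (hlt : ∀ k ∈ S, k < x₀ → h k ≤ 0) (hge : ∀ k ∈ S, x₀ ≤ k → 0 ≤ h k)
    (h1 : ∑ k ∈ S, c k * h k = 0) {w : ℝ} (hw : 0 < w) :
    (1 ≤ w → 0 ≤ ∑ k ∈ S, c k * w ^ k * h k) ∧
      (w ≤ 1 → ∑ k ∈ S, c k * w ^ k * h k ≤ 0) := by
  -- Subtracting `w ^ x₀` times the vanishing sum `h1` makes both factors change sign at `x₀`, so
  -- every term has the same sign.
  have key : ∑ k ∈ S, c k * w ^ k * h k = ∑ k ∈ S, c k * ((w ^ k - w ^ x₀) * h k) := by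
    have : ∑ k ∈ S, c k * ((w ^ k - w ^ x₀) * h k) =
        ∑ k ∈ S, c k * w ^ k * h k - w ^ x₀ * ∑ k ∈ S, c k * h k := by
      rw [Finset.mul_sum, ← Finset.sum_sub_distrib]
      exact Finset.sum_congr rfl fun k _ => by ring
    rw [this, h1]; ring
  rw [key]
  refine ⟨fun hw1 => Finset.sum_nonneg fun k hk => mul_nonneg (hc k hk) ?_,
    fun hw1 => Finset.sum_nonpos fun k hk => mul_nonpos_of_nonneg_of_nonpos (hc k hk) ?_⟩
  · rcases lt_or_ge k x₀ with h' | h'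
    · exact mul_nonneg_of_nonpos_of_nonpos
        (sub_nonpos.2 (pow_le_pow_right₀ hw1 h'.le)) (hlt k hk h')
    · exact mul_nonneg (sub_nonneg.2 (pow_le_pow_right₀ hw1 h')) (hge k hk h')
  · rcases lt_or_ge k x₀ with h' | h'
    · exact mul_nonpos_of_nonneg_of_nonpos
        (sub_nonneg.2 (pow_le_pow_of_le_one hw.le hw1 h'.le)) (hlt k hk h')
    · exact mul_nonpos_of_nonpos_of_nonneg
        (sub_nonpos.2 (pow_le_pow_of_le_one hw.le hw1 h')) (hge k hk h')

/-- The weight at `w` is the weight at `1` times `w ^ k`, and the normalizing constants are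
positive, so `sum_tilt_of_crossing` applies to `g' - g`. -/
lemma integral_hyperLaw_of_crossing {t : Margins} {g g' : ℕ → ℝ} (x₀ : ℕ)
    (hlt : ∀ k ∈ hyperSupport t, k < x₀ → g' k ≤ g k)
    (hge : ∀ k ∈ hyperSupport t, x₀ ≤ k → g k ≤ g' k)
    (h1 : ∫ h, g h ∂(hyperLaw t 1) = ∫ h, g' h ∂(hyperLaw t 1)) {w : ℝ} (hw : 0 < w) :
    (1 ≤ w → ∫ h, g h ∂(hyperLaw t w) ≤ ∫ h, g' h ∂(hyperLaw t w)) ∧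
      (w ≤ 1 → ∫ h, g' h ∂(hyperLaw t w) ≤ ∫ h, g h ∂(hyperLaw t w)) := by
  by_cases ht : Feasible t
  swap
  · have : hyperSupport t = ∅ := Finset.not_nonempty_iff_eq_empty.1 ht
    simp [hyperLaw, this]
  rw [integral_hyperLaw t one_pos, integral_hyperLaw t one_pos] at h1
  rw [integral_hyperLaw t hw, integral_hyperLaw t hw]
  have e : ∀ v : ℝ, ∑ k ∈ hyperSupport t, hyperMass t v k * g' k -
      ∑ k ∈ hyperSupport t, hyperMass t v k * g k =
      (∑ k ∈ hyperSupport t, hyperWeight t 1 k * v ^ k * (g' k - g k)) /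
        ∑ k ∈ hyperSupport t, hyperWeight t v k := by
    intro v
    rw [← Finset.sum_sub_distrib, Finset.sum_div]
    refine Finset.sum_congr rfl fun k _ => ?_
    simp only [hyperMass, hyperWeight, one_pow]
    ring
  have h1' : ∑ k ∈ hyperSupport t, hyperWeight t 1 k * (g' k - g k) = 0 := by
    have := e 1
    rw [h1, sub_self, eq_comm, div_eq_zero_iff,
      or_iff_left (sum_hyperWeight_pos ht one_pos).ne'] at this
    simpa using this
  obtain ⟨ha, hb⟩ := sum_tilt_of_crossing (fun k hk => (hyperWeight_pos one_pos hk).le) x₀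
    (fun k hk hk' => sub_nonpos.2 (hlt k hk hk')) (fun k hk hk' => sub_nonneg.2 (hge k hk hk'))
    h1' hw
  have hpos := (sum_hyperWeight_pos ht hw).le
  refine ⟨fun hw1 => ?_, fun hw1 => ?_⟩
  · rw [← sub_nonneg, e]; exact div_nonneg (ha hw1) hpos
  · rw [← sub_nonpos, e]; exact div_nonpos_of_nonpos_of_nonneg (hb hw1) hpos

/-- Expectations of monotone functions increase with the odds ratio. -/
lemma integral_hyperLaw_le_of_monotone {t : Margins} (ht : Feasible t) {g : ℕ → ℝ}
    (hg : Monotone g) {w : ℝ} (hw : 0 < w) (hw1 : w ≤ 1) :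
    ∫ h, g h ∂(hyperLaw t w) ≤ ∫ h, g h ∂(hyperLaw t 1) := by
  set a := ∫ h, g h ∂(hyperLaw t 1) with ha
  have hconst : ∀ v : ℝ, 0 < v → ∫ _, a ∂(hyperLaw t v) = a := by
    intro v hv
    rw [integral_hyperLaw t hv, ← Finset.sum_mul, sum_hyperMass ht hv, one_mul]
  -- A monotone function crosses the constant equal to its null mean once. If it never reaches that
  -- constant, any `x₀` beyond the support will do.
  obtain ⟨x₀, hx₀⟩ : ∃ x₀, ∀ k ∈ hyperSupport t, (k < x₀ → g k ≤ a) ∧ (x₀ ≤ k → a ≤ g k) := by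
    by_cases h : ∃ k, a ≤ g k
    · classical
      refine ⟨Nat.find h, fun k _ => ⟨fun hk => ?_, fun hk => ?_⟩⟩
      · exact (not_le.1 (Nat.find_min h hk)).le
      · exact (Nat.find_spec h).trans (hg hk)
    · push Not at h
      refine ⟨(hyperSupport t).sup id + 1, fun k hk => ⟨fun _ => (h k).le, fun hk' => ?_⟩⟩
      have : k ≤ (hyperSupport t).sup id := Finset.le_sup (f := id) hk
      omega
  have := (integral_hyperLaw_of_crossing (g := fun _ => a) (g' := g) x₀
    (fun k hk => (hx₀ k hk).1) (fun k hk => (hx₀ k hk).2) (hconst 1 one_pos) hw).2 hw1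
  rwa [hconst w hw] at this

/-! ### Databases with fixed margins -/

lemma table_row {n : ℕ} (X : Database n) (i : Fin 2) :
    table X i 0 + table X i 1 = (margins X).1 i := by
  simp only [table, margins]
  rw [← Finset.card_union_of_disjoint]
  · congr 1
    ext k
    rcases h : X k with ⟨a, b⟩
    simp only [Finset.mem_union, Finset.mem_filter, Finset.mem_univ, true_and, h, Prod.mk.injEq]
    fin_cases b <;> simp
  · rw [Finset.disjoint_filter]
    intro k _ h h'
    rw [h] at h'
    simp at h'

lemma table_col {n : ℕ} (X : Database n) (j : Fin 2) :
    table X 0 j + table X 1 j = (margins X).2 j := by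
  simp only [table, margins]
  rw [← Finset.card_union_of_disjoint]
  · congr 1
    ext k
    rcases h : X k with ⟨a, b⟩
    simp only [Finset.mem_union, Finset.mem_filter, Finset.mem_univ, true_and, h, Prod.mk.injEq]
    fin_cases a <;> simp
  · rw [Finset.disjoint_filter]
    intro k _ h h'
    rw [h] at h'
    simp at h'

lemma table_mem_hyperSupport {n : ℕ} {t : Margins} {X : Database n} (hX : X ∈ conforming n t) :
    table X 0 0 ∈ hyperSupport t := by
  obtain rfl : margins X = t := hX
  have := table_row X 0
  have := table_row X 1
  have := table_col X 0
  simp only [hyperSupport, Finset.mem_Icc, le_min_iff]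
  omega

lemma table_eq_tableOf {n : ℕ} {t : Margins} {X : Database n} (hX : X ∈ conforming n t) :
    table X = tableOf t (table X 0 0) := by
  obtain rfl : margins X = t := hX
  have := table_row X 0
  have := table_row X 1
  have := table_col X 0
  funext i j
  fin_cases i <;> fin_cases j <;> simp [tableOf] <;> omega

/-- Permute the first features by `σ` and the second features by `τ`. -/
def permute {n : ℕ} (σ τ : Equiv.Perm (Fin n)) (X : Database n) : Database n :=
  fun k => ((X (σ k)).1, (X (τ k)).2)

lemma margins_permute {n : ℕ} (σ τ : Equiv.Perm (Fin n)) (X : Database n) :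
    margins (permute σ τ X) = margins X := by
  have key : ∀ (ρ : Equiv.Perm (Fin n)) (p : Fin n → Prop) [DecidablePred p],
      (Finset.univ.filter fun k => p (ρ k)).card = (Finset.univ.filter p).card := by
    intro ρ p _
    exact Finset.card_equiv ρ (by simp)
  simp only [margins, permute]
  ext i
  · exact key σ fun k => (X k).1 = i
  · exact key τ fun k => (X k).2 = i

lemma hammingDist_le_two {n : ℕ} {X Y : Database n} {i j : Fin n}
    (h : ∀ k, k ≠ i → k ≠ j → X k = Y k) : hammingDist X Y ≤ 2 := by
  refine (Finset.card_le_card (t := {i, j}) fun k hk => ?_).trans Finset.card_le_two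
  simp only [Finset.mem_filter, Finset.mem_univ, true_and] at hk
  by_contra hk'
  simp only [Finset.mem_insert, Finset.mem_singleton, not_or] at hk'
  exact hk (h k hk'.1 hk'.2)

lemma hammingDist_permute_le {n : ℕ} {σ τ : Equiv.Perm (Fin n)} {i j : Fin n}
    (hσ : σ = 1 ∨ σ = Equiv.swap i j) (hτ : τ = 1 ∨ τ = Equiv.swap i j) (X : Database n) :
    hammingDist X (permute σ τ X) ≤ 2 := by
  refine hammingDist_le_two (i := i) (j := j) fun k hi hj => ?_
  have h1 : σ k = k := by
    rcases hσ with rfl | rfl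
    · rfl
    · exact Equiv.swap_apply_of_ne_of_ne hi hj
  have h2 : τ k = k := by
    rcases hτ with rfl | rfl
    · rfl
    · exact Equiv.swap_apply_of_ne_of_ne hi hj
  simp [permute, h1, h2]

lemma table_pos_of_eq {n : ℕ} {X : Database n} {i : Fin n} {a b : Fin 2} (h : X i = (a, b)) :
    0 < table X a b :=
  Finset.card_pos.2 ⟨i, by simp [h]⟩

lemma exists_of_table_pos {n : ℕ} {X : Database n} {a b : Fin 2} (h : 0 < table X a b) :
    ∃ i, X i = (a, b) := by
  obtain ⟨i, hi⟩ := Finset.card_pos.1 h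
  exact ⟨i, by simpa using hi⟩

/-- Write `X i = (a, b)` and `Y i = (a', b')`. In every conforming database, the total of column `b`
minus the total of row `a'` is the count of `(a, b)` minus the count of `(a', b')`. If both
conclusions failed, this difference would be positive for `X` and negative for `Y`. -/
lemma exists_opposite {n : ℕ} {t : Margins} {X Y : Database n} (hX : X ∈ conforming n t)
    (hY : Y ∈ conforming n t) {i : Fin n} (h1 : (X i).1 ≠ (Y i).1) (h2 : (X i).2 ≠ (Y i).2) :
    (∃ j, X j = Y i) ∨ ∃ j, Y j = X i := by
  have hX' : margins X = t := hX
  have hY' : margins Y = t := hY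
  have r0 := table_row X 0
  have r1 := table_row X 1
  have c0 := table_col X 0
  have c1 := table_col X 1
  have r0' := table_row Y 0
  have r1' := table_row Y 1
  have c0' := table_col Y 0
  have c1' := table_col Y 1
  rw [hX'] at r0 r1 c0 c1
  rw [hY'] at r0' r1' c0' c1'
  rcases hx : X i with ⟨a, b⟩
  rcases hy : Y i with ⟨a', b'⟩
  rw [hx, hy] at h1 h2
  have px := table_pos_of_eq hx
  have py := table_pos_of_eq hy
  have : 0 < table X a' b' ∨ 0 < table Y a b := by
    fin_cases a <;> fin_cases a' <;> fin_cases b <;> fin_cases b' <;> simp_all <;> omega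
  exact this.imp exists_of_table_pos exists_of_table_pos

lemma exists_eq_of_margins_eq {n : ℕ} {t : Margins} {X Y : Database n} (hX : X ∈ conforming n t)
    (hY : Y ∈ conforming n t) (i : Fin n) :
    (∃ j, (X j).1 = (Y i).1) ∧ ∃ j, (X j).2 = (Y i).2 := by
  have h : margins X = margins Y := Eq.trans hX (Eq.symm hY)
  have h1 : (Finset.univ.filter fun k => (X k).1 = (Y i).1).card =
      (Finset.univ.filter fun k => (Y k).1 = (Y i).1).card := congrFun (congrArg Prod.fst h) _
  have h2 : (Finset.univ.filter fun k => (X k).2 = (Y i).2).card =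
      (Finset.univ.filter fun k => (Y k).2 = (Y i).2).card := congrFun (congrArg Prod.snd h) _
  have p1 : 0 < (Finset.univ.filter fun k => (Y k).1 = (Y i).1).card :=
    Finset.card_pos.2 ⟨i, by simp⟩
  have p2 : 0 < (Finset.univ.filter fun k => (Y k).2 = (Y i).2).card :=
    Finset.card_pos.2 ⟨i, by simp⟩
  rw [← h1] at p1
  rw [← h2] at p2
  obtain ⟨j, hj⟩ := Finset.card_pos.1 p1
  obtain ⟨k, hk⟩ := Finset.card_pos.1 p2
  exact ⟨⟨j, by simpa using hj⟩, ⟨k, by simpa using hk⟩⟩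

/-- A record of one individual can be replaced by any other feasible record at the cost of
changing at most one other record. -/
lemma exists_replacement {n : ℕ} {t : Margins} {X Y : Database n} (hX : X ∈ conforming n t)
    (hY : Y ∈ conforming n t) (i : Fin n) :
    ∃ X' ∈ conforming n t, ∃ Y' ∈ conforming n t,
      X' i = X i ∧ Y' i = Y i ∧ hammingDist X' Y' ≤ 2 := by
  have hperm : ∀ σ τ (Z : Database n), Z ∈ conforming n t → permute σ τ Z ∈ conforming n t :=
    fun σ τ Z hZ => (margins_permute σ τ Z).trans hZ
  -- If the records share a feature, exchanging only the other one with a suitable individual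
  -- suffices. Otherwise a whole record is exchanged, in whichever database contains the opposite
  -- one.
  by_cases h1 : (X i).1 = (Y i).1
  · obtain ⟨j, hj⟩ := (exists_eq_of_margins_eq hX hY i).2
    refine ⟨X, hX, permute 1 (Equiv.swap i j) X, hperm _ _ _ hX, rfl, ?_,
      hammingDist_permute_le (.inl rfl) (.inr rfl) X⟩
    simp [permute, h1, hj]
  by_cases h2 : (X i).2 = (Y i).2
  · obtain ⟨j, hj⟩ := (exists_eq_of_margins_eq hX hY i).1
    refine ⟨X, hX, permute (Equiv.swap i j) 1 X, hperm _ _ _ hX, rfl, ?_,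
      hammingDist_permute_le (.inr rfl) (.inl rfl) X⟩
    simp [permute, h2, hj]
  rcases exists_opposite hX hY h1 h2 with ⟨j, hj⟩ | ⟨j, hj⟩
  · refine ⟨X, hX, permute (Equiv.swap i j) (Equiv.swap i j) X, hperm _ _ _ hX, rfl, ?_,
      hammingDist_permute_le (.inr rfl) (.inr rfl) X⟩
    simp [permute, hj]
  · refine ⟨permute (Equiv.swap i j) (Equiv.swap i j) Y, hperm _ _ _ hY, Y, hY, ?_, rfl, ?_⟩
    · simp [permute, hj]
    · rw [hammingDist_comm]
      exact hammingDist_permute_le (.inr rfl) (.inr rfl) Y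

lemma semiAdjParam_conforming_le (n : ℕ) (t : Margins) : semiAdjParam (conforming n t) ≤ 2 := by
  unfold semiAdjParam
  refine iSup_le fun i => iSup₂_le fun x hx => iSup₂_le fun y hy => ?_
  obtain ⟨X, hX, rfl⟩ := hx
  obtain ⟨Y, hY, rfl⟩ := hy
  obtain ⟨X', hX', Y', hY', h1, h2, h3⟩ := exists_replacement hX hY i
  refine iInf₂_le_of_le X' Y' (iInf_le_of_le ⟨hX', hY', h1, h2⟩ ?_)
  exact_mod_cast h3

/-- If only record `i` differed, equality of each margin would force the corresponding feature of
that record to agree. -/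
lemma two_le_hammingDist {n : ℕ} {t : Margins} {X Y : Database n} (hX : X ∈ conforming n t)
    (hY : Y ∈ conforming n t) (hne : X ≠ Y) : 2 ≤ hammingDist X Y := by
  by_contra hlt
  obtain ⟨i, hi⟩ := Function.ne_iff.1 hne
  have hoff : ∀ k, k ≠ i → X k = Y k := by
    intro k hk
    by_contra hk'
    apply hlt
    have : ({i, k} : Finset (Fin n)) ⊆ Finset.univ.filter fun l => X l ≠ Y l := by
      intro l hl
      simp only [Finset.mem_insert, Finset.mem_singleton] at hl
      rcases hl with rfl | rfl <;> simpa
    have h2 := Finset.card_le_card this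
    rwa [Finset.card_pair hk.symm] at h2
  have key : ∀ g : Fin 2 × Fin 2 → Fin 2,
      (Finset.univ.filter fun k => g (X k) = g (X i)).card =
        (Finset.univ.filter fun k => g (Y k) = g (X i)).card → g (X i) = g (Y i) := by
    intro g hg
    have hsub : (Finset.univ.filter fun k => g (Y k) = g (X i)) ⊆
        Finset.univ.filter fun k => g (X k) = g (X i) := by
      intro k hk
      simp only [Finset.mem_filter, Finset.mem_univ, true_and] at hk ⊢
      by_cases hki : k = i
      · rw [hki]
      · rwa [hoff k hki]
    have heq := Finset.eq_of_subset_of_card_le hsub hg.le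
    have : i ∈ Finset.univ.filter fun k => g (Y k) = g (X i) := by rw [heq]; simp
    simpa [eq_comm] using this
  have h : margins X = margins Y := Eq.trans hX (Eq.symm hY)
  exact hi (Prod.ext (key Prod.fst (congrFun (congrArg Prod.fst h) _))
    (key Prod.snd (congrFun (congrArg Prod.snd h) _)))

lemma two_le_semiAdjParam {n : ℕ} {t : Margins} {X Y : Database n} (hX : X ∈ conforming n t)
    (hY : Y ∈ conforming n t) (hne : X ≠ Y) : 2 ≤ semiAdjParam (conforming n t) := by
  obtain ⟨i, hi⟩ := Function.ne_iff.1 hne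
  unfold semiAdjParam
  refine le_iSup_of_le i (le_iSup₂_of_le (X i) ⟨X, hX, rfl⟩
    (le_iSup₂_of_le (Y i) ⟨Y, hY, rfl⟩ (le_iInf₂ fun X' Y' => le_iInf fun h => ?_)))
  have : X' ≠ Y' := by
    rintro rfl
    exact hi (h.2.2.1.symm.trans h.2.2.2)
  exact_mod_cast two_le_hammingDist h.1 h.2.1 this

/-- Semi-adjacent databases have counts `x₁₁` that differ by at most one. -/
lemma table_le_of_hammingDist_le {n : ℕ} {t : Margins} {X Y : Database n}
    (hX : X ∈ conforming n t) (hY : Y ∈ conforming n t) (h : hammingDist X Y ≤ 2) :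
    table Y 0 0 ≤ table X 0 0 + 1 := by
  have hX' : margins X = t := hX
  have hY' : margins Y = t := hY
  have r0 := table_row X 0
  have c0 := table_col X 0
  have r0' := table_row Y 0
  have c0' := table_col Y 0
  rw [hX'] at r0 c0
  rw [hY'] at r0' c0'
  -- With fixed margins, a rise of `x₁₁` by `d` lowers both off-diagonal counts by `d`. This needs
  -- `2 * d` distinct changed records, so `d ≤ 1`.
  have key : ∀ a b, table X a b ≤ table Y a b +
      (Finset.univ.filter fun k => X k ≠ Y k ∧ X k = (a, b)).card := by
    intro a b
    refine (Finset.card_le_card fun k hk => ?_).trans (Finset.card_union_le _ _)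
    simp only [Finset.mem_union, Finset.mem_filter, Finset.mem_univ, true_and] at hk ⊢
    by_cases hxy : X k = Y k
    · exact .inl (hxy ▸ hk)
    · exact .inr ⟨hxy, hk⟩
  have hsum : (Finset.univ.filter fun k => X k ≠ Y k ∧ X k = (0, 1)).card +
      (Finset.univ.filter fun k => X k ≠ Y k ∧ X k = (1, 0)).card ≤ hammingDist X Y := by
    rw [← Finset.card_union_of_disjoint]
    · refine Finset.card_le_card fun k hk => ?_
      simp only [Finset.mem_union, Finset.mem_filter, Finset.mem_univ, true_and] at hk ⊢
      exact hk.elim And.left And.left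
    · rw [Finset.disjoint_filter]
      rintro k _ ⟨_, h1⟩ ⟨_, h2⟩
      rw [h1] at h2
      simp at h2
  have := key 0 1
  have := key 1 0
  omega

/-- Individuals in the cells `(0, b)` and `(1, 1 - b)` exchange their second features. The case `b =
1` raises `x₁₁` and `b = 0` lowers it. -/
lemma exists_move {n : ℕ} {t : Margins} {X : Database n} (hX : X ∈ conforming n t)
    {b : Fin 2} (h01 : 0 < table X 0 b) (h10 : 0 < table X 1 (1 - b)) :
    ∃ Y ∈ conforming n t, hammingDist X Y ≤ 2 ∧ table Y 0 b + 1 = table X 0 b := by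
  obtain ⟨i, hi⟩ := exists_of_table_pos h01
  obtain ⟨j, hj⟩ := exists_of_table_pos h10
  refine ⟨permute 1 (Equiv.swap i j) X, (margins_permute _ _ _).trans hX,
    hammingDist_permute_le (.inl rfl) (.inr rfl) X, ?_⟩
  have hb : (1 - b : Fin 2) ≠ b := by fin_cases b <;> simp
  have : (Finset.univ.filter fun k => permute 1 (Equiv.swap i j) X k = (0, b)) =
      (Finset.univ.filter fun k => X k = (0, b)).erase i := by
    ext k
    simp only [Finset.mem_filter, Finset.mem_univ, true_and, Finset.mem_erase]
    by_cases hki : k = i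
    · subst hki
      simp [permute, hi, hj, hb]
    by_cases hkj : k = j
    · subst hkj
      simp [permute, hi, hj]
    simp [permute, hki, Equiv.swap_apply_of_ne_of_ne hki hkj, Prod.ext_iff]
  simp only [table, this]
  exact Finset.card_erase_add_one (by simp [hi])

/-- The count `x₁₁` can be raised by one within distance two, below the upper end of the
support. -/
lemma exists_move_up {n : ℕ} {t : Margins} {X : Database n} (hX : X ∈ conforming n t)
    (h : table X 0 0 + 1 ∈ hyperSupport t) :
    ∃ Y ∈ conforming n t, hammingDist X Y ≤ 2 ∧ table Y 0 0 = table X 0 0 + 1 := by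
  have hX' : margins X = t := hX
  have r0 := table_row X 0
  have c0 := table_col X 0
  rw [hX'] at r0 c0
  simp only [hyperSupport, Finset.mem_Icc, le_min_iff] at h
  obtain ⟨Y, hY, hd, hYX⟩ := exists_move (b := 1) hX (by omega)
    (show 0 < table X 1 0 by omega)
  have hY' : margins Y = t := hY
  have r0' := table_row Y 0
  rw [hY'] at r0'
  exact ⟨Y, hY, hd, by omega⟩

lemma exists_move_down {n : ℕ} {t : Margins} {X : Database n} (hX : X ∈ conforming n t)
    {x : ℕ} (hx : table X 0 0 = x + 1) (h : x ∈ hyperSupport t) :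
    ∃ Y ∈ conforming n t, table Y 0 0 = x := by
  have hX' : margins X = t := hX
  have r1 := table_row X 1
  have c0 := table_col X 0
  rw [hX'] at r1 c0
  simp only [hyperSupport, Finset.mem_Icc, le_min_iff] at h
  obtain ⟨Y, hY, hd, hYX⟩ := exists_move (b := 0) hX (by omega)
    (show 0 < table X 1 1 by omega)
  exact ⟨Y, hY, by omega⟩

/-- Every point of the support is the count of a conforming database. -/
lemma exists_database {n : ℕ} {t : Margins} {Xstar : Database n} (h0 : Xstar ∈ conforming n t)
    {x : ℕ} (hx : x ∈ hyperSupport t) : ∃ X ∈ conforming n t, table X 0 0 = x := by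
  have hs := table_mem_hyperSupport h0
  simp only [hyperSupport, Finset.mem_Icc] at hs hx
  rcases le_total (table Xstar 0 0) x with hle | hle
  · induction x, hle using Nat.le_induction with
    | base => exact ⟨Xstar, h0, rfl⟩
    | succ k hk ih =>
      obtain ⟨X, hX, rfl⟩ := ih ⟨by omega, by omega⟩
      obtain ⟨Y, hY, _, hYX⟩ := exists_move_up hX (by simpa [hyperSupport] using hx)
      exact ⟨Y, hY, hYX⟩
  · induction hle using Nat.decreasingInduction with
    | self => exact ⟨Xstar, h0, rfl⟩
    | of_succ k hk ih =>
      obtain ⟨X, hX, hXk⟩ := ih ⟨by omega, by omega⟩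
      exact exists_move_down hX hXk (by simpa [hyperSupport] using hx)

/-- Neighbouring points of the support are realized by semi-adjacent databases. -/
lemma exists_adjacent {n : ℕ} {t : Margins} {Xstar : Database n} (h0 : Xstar ∈ conforming n t)
    {x : ℕ} (hx : x ∈ hyperSupport t) (hx1 : x + 1 ∈ hyperSupport t) :
    ∃ X ∈ conforming n t, ∃ Y ∈ conforming n t,
      hammingAdj (semiAdjParam (conforming n t)) X Y ∧ table X 0 0 = x ∧
        table Y 0 0 = x + 1 := by
  obtain ⟨X, hX, rfl⟩ := exists_database h0 hx
  obtain ⟨Y, hY, hd, hYX⟩ := exists_move_up hX hx1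
  refine ⟨X, hX, Y, hY, ?_, rfl, hYX⟩
  have hne : X ≠ Y := by
    rintro rfl
    omega
  exact le_trans (by exact_mod_cast hd) (two_le_semiAdjParam hX hY hne)

lemma table_le_of_adjacent {n : ℕ} {t : Margins} {X Y : Database n}
    (hX : X ∈ conforming n t) (hY : Y ∈ conforming n t)
    (h : hammingAdj (semiAdjParam (conforming n t)) X Y) :
    table Y 0 0 ≤ table X 0 0 + 1 ∧ table X 0 0 ≤ table Y 0 0 + 1 := by
  have hd : hammingDist X Y ≤ 2 := by
    exact_mod_cast (le_trans h (semiAdjParam_conforming_le n t) : (hammingDist X Y : ℕ∞) ≤ 2)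
  exact ⟨table_le_of_hammingDist_le hX hY hd,
    table_le_of_hammingDist_le hY hX (hammingDist_comm X Y ▸ hd)⟩

/-! ### Tradeoff functions and canonical noise -/

section Tradeoff

variable {Y Z : Type*} [MeasurableSpace Y] [MeasurableSpace Z]

lemma tradeoff_le {P Q : Measure Y} [IsProbabilityMeasure Q] {α : ℝ} {g : Y → ℝ}
    (hg : Measurable g) (h01 : ∀ y, 0 ≤ g y ∧ g y ≤ 1) (hP : ∫ y, g y ∂P ≤ 1 - α) :
    tradeoff P Q α ≤ 1 - ∫ y, g y ∂Q := by
  refine csInf_le ⟨0, ?_⟩ ⟨g, hg, h01, hP, rfl⟩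
  rintro b ⟨g', hg', h01', -, rfl⟩
  have : ∫ y, g' y ∂Q ≤ ∫ _, (1 : ℝ) ∂Q := by
    refine integral_mono_of_nonneg (.of_forall fun y => (h01' y).1) (integrable_const _)
      (.of_forall fun y => (h01' y).2)
  simpa using this

/-- Post-processing: a test of the images pulls back along `k` to a test of the originals. The zero
test, admissible as `α ≤ 1`, keeps the infimum from being over the empty set. -/
lemma tradeoff_le_tradeoff_map {P Q : Measure Y} [IsProbabilityMeasure Q] {k : Y → Z}
    (hk : Measurable k) {α : ℝ} (hα : α ≤ 1) :
    tradeoff P Q α ≤ tradeoff (P.map k) (Q.map k) α := by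
  refine le_csInf ⟨1 - ∫ _, (0 : ℝ) ∂(Q.map k), fun _ => 0, measurable_const, by simp, ?_, rfl⟩ ?_
  · simpa using hα
  · rintro b ⟨g, hg, h01, hP, rfl⟩
    rw [integral_map hk.aemeasurable hg.aestronglyMeasurable] at hP ⊢
    exact tradeoff_le (hg.comp hk) (fun y => h01 (k y)) hP

end Tradeoff

lemma IsDP.map {D Y Z : Type*} [MeasurableSpace Y] [MeasurableSpace Z] {S : Set D}
    {A : D → D → Prop} {f : ℝ → ℝ} {M : D → Measure Y} [∀ X, IsProbabilityMeasure (M X)]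
    (hM : IsDP S A f M) {k : Y → Z} (hk : Measurable k) :
    IsDP S A f (fun X => (M X).map k) :=
  fun X hX X' hX' h α hα => (hM X hX X' hX' h α hα).trans (tradeoff_le_tradeoff_map hk hα.2)

lemma measurable_decide_le (m : ℝ) : Measurable fun u : ℝ => decide (m ≤ u) := by
  refine measurable_to_bool ?_
  have : (fun u : ℝ => decide (m ≤ u)) ⁻¹' {true} = Set.Ici m := by
    ext u
    simp
  rw [this]
  exact measurableSet_Ici

/-- The distribution function of canonical noise satisfies `f (F c) = F (c - 1)` below level one;
this is the inequality that does not come from a test. -/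
lemma IsCND.cdf_sub_one_le {f : ℝ → ℝ} {ν : Measure ℝ} (hf : IsTradeoffFunction f) (hν : IsCND f ν)
    {c : ℝ} (h0 : 0 < cdf ν c) (h1 : cdf ν c < 1) : cdf ν (c - 1) ≤ f (cdf ν c) := by
  -- Where `F` is flat, the quantile of `F c` may lie left of `c`. Levels `β > F c` have quantile at
  -- least `c`; then `β` decreases to `F c` and `f` is continuous.
  have hstep : ∀ β ∈ Set.Ioo (cdf ν c) 1, cdf ν (c - 1) ≤ f β := by
    intro β hβ
    have hβ' : β ∈ Set.Ioo (0 : ℝ) 1 := ⟨h0.trans hβ.1, hβ.2⟩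
    rw [hν.tight β hβ', hν.threshold β hβ']
    refine monotone_cdf ν (sub_le_sub_right ?_ 1)
    obtain ⟨b, hb⟩ := ((tendsto_cdf_atTop ν).eventually (eventually_ge_nhds hβ.2)).exists
    refine le_csInf ⟨b, hb⟩ fun x hx => ?_
    by_contra hlt
    exact absurd (hβ.1.trans_le hx) (not_lt.2 (monotone_cdf ν (not_le.1 hlt).le))
  have hcont : Filter.Tendsto f (nhdsWithin (cdf ν c) (Set.Ioo (cdf ν c) 1))
      (nhds (f (cdf ν c))) :=
    (hf.continuous _ ⟨h0.le, h1.le⟩).mono_left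
      (nhdsWithin_mono _ fun β hβ => ⟨(h0.trans hβ.1).le, hβ.2.le⟩)
  have : (nhdsWithin (cdf ν c) (Set.Ioo (cdf ν c) 1)).NeBot := by
    rw [nhdsWithin_Ioo_eq_nhdsGT h1]
    infer_instance
  exact ge_of_tendsto hcont (eventually_mem_nhdsWithin.mono hstep)

section CND

variable {f : ℝ → ℝ} {ν : Measure ℝ} [IsProbabilityMeasure ν]

lemma IsCND.nullSingletonClass (hν : IsCND f ν) : NullSingletonClass ν := by
  refine ⟨fun x => ?_⟩
  rw [← measure_cdf ν, StieltjesFunction.measure_singleton,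
    hν.continuous.continuousWithinAt.leftLim_eq, sub_self, ENNReal.ofReal_zero]

lemma IsCND.measure_Ici (hν : IsCND f ν) (x : ℝ) :
    ν (Set.Ici x) = ENNReal.ofReal (cdf ν (-x)) := by
  have := hν.nullSingletonClass
  have h := hν.symm (-x)
  rw [neg_neg] at h
  rw [← Set.compl_Iio, prob_compl_eq_one_sub measurableSet_Iio, measure_congr Iio_ae_eq_Iic,
    ← ofReal_cdf, h, ENNReal.ofReal_sub _ (cdf_nonneg ν x), ENNReal.ofReal_one]

lemma IsCND.map_neg (hν : IsCND f ν) : ν.map (fun z => -z) = ν := by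
  have : IsProbabilityMeasure (ν.map fun z => -z) := Measure.isProbabilityMeasure_map (by fun_prop)
  refine Measure.ext_of_Iic _ _ fun a => ?_
  rw [Measure.map_apply (by fun_prop) measurableSet_Iic]
  have : (fun z : ℝ => -z) ⁻¹' Set.Iic a = Set.Ici (-a) := by
    ext z
    simp
  rw [this, hν.measure_Ici, neg_neg, ofReal_cdf]

/-- Shifts by at most one, in either direction, are `f`-indistinguishable. -/
lemma IsCND.le_tradeoff_shift (hν : IsCND f ν) {x x' : ℝ} (h : |x - x'| ≤ 1) {α : ℝ}
    (hα : α ∈ Set.Icc (0 : ℝ) 1) :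
    f α ≤ tradeoff (ν.map fun z => x + z) (ν.map fun z => x' + z) α := by
  rw [abs_le] at h
  have hprob : ∀ d : ℝ, IsProbabilityMeasure (ν.map fun z => z + d) :=
    fun d => Measure.isProbabilityMeasure_map (by fun_prop)
  rcases le_total x x' with hle | hle
  · refine (hν.dp (x' - x) ⟨by linarith, by linarith⟩ α hα).trans ?_
    have := hprob (x' - x)
    refine (tradeoff_le_tradeoff_map (k := fun z => x + z) (by fun_prop) hα.2).trans_eq ?_
    rw [Measure.map_map (by fun_prop) (by fun_prop)]
    congr 2
    funext z
    simp only [Function.comp_apply]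
    ring
  -- Canonical noise controls only shifts to the right, so a shift to the left is reflected by `z ↦
  -- x - z`, using the symmetry of `ν`.
  · refine (hν.dp (x - x') ⟨by linarith, by linarith⟩ α hα).trans ?_
    have := hprob (x - x')
    refine (tradeoff_le_tradeoff_map (k := fun z => x - z) (by fun_prop) hα.2).trans_eq ?_
    have e : ∀ y : ℝ, ν.map (fun z => y + z) = ν.map fun z => y - z := by
      intro y
      conv_lhs => rw [← hν.map_neg]
      rw [Measure.map_map (by fun_prop) (by fun_prop)]
      rfl
    rw [Measure.map_map (by fun_prop) (by fun_prop), e, e]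
    congr 2
    funext z
    simp only [Function.comp_apply]
    ring

instance isProbabilityMeasure_noisyCount (n : ℕ) (X : Database n) :
    IsProbabilityMeasure (noisyCount n ν X) :=
  Measure.isProbabilityMeasure_map (by fun_prop)

theorem isSemiDP_noisyCount (hν : IsCND f ν) (n : ℕ) (t : Margins) :
    IsSemiDP t f (noisyCount n ν) := by
  intro X hX X' hX' h α hα
  refine hν.le_tradeoff_shift ?_ hα
  obtain ⟨h1, h2⟩ := table_le_of_adjacent hX hX' h
  have h1' : (table X' 0 0 : ℝ) ≤ table X 0 0 + 1 := by exact_mod_cast h1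
  have h2' : (table X 0 0 : ℝ) ≤ table X' 0 0 + 1 := by exact_mod_cast h2
  rw [abs_le]
  constructor <;> linarith

lemma IsCND.noisyCount_Ici (hν : IsCND f ν) {n : ℕ} (X : Database n) (m : ℝ) :
    noisyCount n ν X (Set.Ici m) = ENNReal.ofReal (cdf ν ((table X 0 0 : ℝ) - m)) := by
  rw [noisyCount, Measure.map_apply (by fun_prop) measurableSet_Ici]
  have : (fun z : ℝ => (table X 0 0 : ℝ) + z) ⁻¹' Set.Ici m =
      Set.Ici (m - (table X 0 0 : ℝ)) := by
    ext z
    simp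
  rw [this, hν.measure_Ici, neg_sub]

/-- The noise test rejects when the noisy count is at least `m`. -/
lemma IsCND.testMechanism_noiseTest (hν : IsCND f ν) (n : ℕ) (m : ℝ) (X : Database n) :
    testMechanism n (noiseTest ν m) X =
      (noisyCount n ν X).map fun u => decide (m ≤ u) := by
  have hk : Measurable fun u : ℝ => decide (m ≤ u) :=
    measurable_decide_le m
  have : IsProbabilityMeasure ((noisyCount n ν X).map fun u => decide (m ≤ u)) :=
    Measure.isProbabilityMeasure_map hk.aemeasurable
  have : IsProbabilityMeasure (testMechanism n (noiseTest ν m) X) := by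
    unfold testMechanism; infer_instance
  have htrue : testMechanism n (noiseTest ν m) X {true} =
      ((noisyCount n ν X).map fun u => decide (m ≤ u)) {true} := by
    rw [Measure.map_apply hk (by simp)]
    have : (fun u : ℝ => decide (m ≤ u)) ⁻¹' {true} = Set.Ici m := by
      ext u
      simp
    rw [this, hν.noisyCount_Ici, testMechanism,
      bernoulliMeasure_apply_of_mem_of_notMem _ (by simp) (by simp) (by simp)]
    rw [ENNReal.ofReal]
    congr 1
    exact (Real.toNNReal_of_nonneg (cdf_nonneg ν _)).symm
  refine Measure.ext_of_singleton fun b => ?_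
  cases b
  · have hc : ({false} : Set Bool) = {true}ᶜ := by ext b; cases b <;> simp
    rw [hc, prob_compl_eq_one_sub (by simp), prob_compl_eq_one_sub (by simp), htrue]
  · exact htrue

theorem isSemiDP_noiseTest (hν : IsCND f ν) (n : ℕ) (t : Margins) (m : ℝ) :
    IsSemiDP t f (testMechanism n (noiseTest ν m)) := by
  have hk : Measurable fun u : ℝ => decide (m ≤ u) :=
    measurable_decide_le m
  have h := IsDP.map (isSemiDP_noisyCount hν n t) hk
  rwa [show testMechanism n (noiseTest ν m) =
    fun X => (noisyCount n ν X).map fun u => decide (m ≤ u) from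
    funext (hν.testMechanism_noiseTest n m)]

end CND

/-- The rejection probabilities of a DP test on neighbouring tables. -/
lemma IsSemiDP.test_le {n : ℕ} {t : Margins} {f : ℝ → ℝ} {φ : TableTest}
    (h : IsSemiDP t f (testMechanism n φ)) {X X' : Database n} (hX : X ∈ conforming n t)
    (hX' : X' ∈ conforming n t) (hA : hammingAdj (semiAdjParam (conforming n t)) X X') :
    (φ (table X') : ℝ) ≤ 1 - f (1 - φ (table X)) := by
  have : IsProbabilityMeasure (testMechanism n φ X') := by
    unfold testMechanism; infer_instance
  have hint : ∀ Z : Database n,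
      ∫ b, (if b = true then (1 : ℝ) else 0) ∂(testMechanism n φ Z) = φ (table Z) := by
    intro Z
    rw [testMechanism, integral_bernoulliMeasure]
    simp
  -- At this level the indicator of rejection meets the constraint under `X` with equality.
  have hα : 1 - (φ (table X) : ℝ) ∈ Set.Icc (0 : ℝ) 1 := by
    have := (φ (table X)).2
    constructor <;> linarith [this.1, this.2]
  have h1 := h X hX X' hX' hA _ hα
  have h2 := tradeoff_le (P := testMechanism n φ X) (Q := testMechanism n φ X')
    (α := 1 - (φ (table X) : ℝ)) (g := fun b => if b = true then (1 : ℝ) else 0)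
    .of_discrete (fun b => by cases b <;> simp) (by rw [hint]; linarith)
  rw [hint] at h2
  linarith

/-! ### The conditional law of the count -/

lemma hyperLaw_singleton (t : Margins) (w : ℝ) (x : ℕ) :
    hyperLaw t w {x} =
      if x ∈ hyperSupport t then ENNReal.ofReal (hyperMass t w x) else 0 := by
  classical
  simp only [hyperLaw, Measure.finsetSum_apply, Measure.smul_apply, smul_eq_mul,
    Measure.dirac_apply' _ (measurableSet_singleton x), Set.indicator_apply,
    Set.mem_singleton_iff, Pi.one_apply, mul_ite, mul_one, mul_zero]
  rw [Finset.sum_ite_eq' (hyperSupport t) x]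
  rfl

lemma twoBinomial_singleton (t : Margins) (θ₁ θ₂ : unitInterval) (x y : ℕ) :
    twoBinomial t θ₁ θ₂ {(x, y)} =
      ENNReal.ofReal (((t.1 0).choose x * θ₁ ^ x * (1 - θ₁) ^ (t.1 0 - x)) *
        ((t.1 1).choose y * θ₂ ^ y * (1 - θ₂) ^ (t.1 1 - y))) := by
  rw [twoBinomial, ← Set.singleton_prod_singleton, Measure.prod_prod, binomial_singleton,
    binomial_singleton, ENNReal.ofReal_mul binomial_nonneg]

lemma binomial_mass_eq {θ : ℝ} (h1 : θ < 1) (n x : ℕ) :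
    (n.choose x : ℝ) * θ ^ x * (1 - θ) ^ (n - x) =
      (1 - θ) ^ n * (n.choose x * (θ / (1 - θ)) ^ x) := by
  have hθ : (1 - θ) ≠ 0 := by linarith
  rcases le_or_gt x n with h | h
  · obtain ⟨k, rfl⟩ := Nat.exists_eq_add_of_le h
    rw [Nat.add_sub_cancel_left, pow_add, div_pow]
    field_simp
  · simp [Nat.choose_eq_zero_of_lt h]

/-- On the event that the first column total is `t.₁`, the joint mass of the counts is
proportional to the hypergeometric weight. -/
lemma exists_twoBinomial_singleton_eq (t : Margins) {θ₁ θ₂ : unitInterval} (h1 : θ₁ < 1)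
    (h2 : 0 < θ₂) (h2' : θ₂ < 1) :
    ∃ K : ℝ, 0 < K ∧ ∀ x ≤ t.2 0, twoBinomial t θ₁ θ₂ {(x, t.2 0 - x)} =
      ENNReal.ofReal (K * hyperWeight t (oddsRatio θ₁ θ₂) x) := by
  have a1 : (0 : ℝ) < 1 - θ₁ := sub_pos.2 h1
  have a2 : (0 : ℝ) < 1 - θ₂ := sub_pos.2 h2'
  have a3 : (0 : ℝ) < θ₂ := h2
  -- The second odds carry the exponent `t.2 0 - x`; taking out their full power `t.2 0` leaves the
  -- odds ratio to the power `x`.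
  refine ⟨(1 - θ₁) ^ t.1 0 * (1 - θ₂) ^ t.1 1 * ((θ₂ : ℝ) / (1 - θ₂)) ^ t.2 0,
    by positivity, fun x hx => ?_⟩
  rw [twoBinomial_singleton, binomial_mass_eq (by simpa using h1),
    binomial_mass_eq (by simpa using h2'), hyperWeight, oddsRatio]
  congr 1
  have : ((θ₂ : ℝ) / (1 - θ₂)) ^ t.2 0 =
      ((θ₂ : ℝ) / (1 - θ₂)) ^ (t.2 0 - x) * ((θ₂ : ℝ) / (1 - θ₂)) ^ x := by
    rw [← pow_add, Nat.sub_add_cancel hx]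
  have hne : ((θ₂ : ℝ) / (1 - θ₂)) ^ x ≠ 0 := by positivity
  rw [this, div_pow (_ / _) (_ / _)]
  generalize ((θ₂ : ℝ) / (1 - θ₂)) ^ x = b at hne ⊢
  generalize ((θ₁ : ℝ) / (1 - θ₁)) ^ x = a
  field_simp

theorem conditionalLaw_eq_hyperLaw {t : Margins} (ht : Feasible t) {θ₁ θ₂ : unitInterval}
    (h1 : 0 < θ₁) (h1' : θ₁ < 1) (h2 : 0 < θ₂) (h2' : θ₂ < 1) :
    conditionalLaw t θ₁ θ₂ = hyperLaw t (oddsRatio θ₁ θ₂) := by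
  classical
  set w := oddsRatio θ₁ θ₂ with hw_def
  have hw : 0 < w := by
    have b1 : (0 : ℝ) < θ₁ := h1
    have b2 : (0 : ℝ) < θ₂ := h2
    have a1 : (0 : ℝ) < 1 - θ₁ := sub_pos.2 h1'
    have a2 : (0 : ℝ) < 1 - θ₂ := sub_pos.2 h2'
    rw [hw_def, oddsRatio]
    positivity
  obtain ⟨K, hK, hmass⟩ := exists_twoBinomial_singleton_eq t h1' h2 h2'
  rw [← hw_def] at hmass
  set s : Set (ℕ × ℕ) := {q | q.1 + q.2 = t.2 0} with hs_def
  have hs : MeasurableSet s := .of_discrete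
  -- Off the support a binomial coefficient vanishes, so the sum over the conditioning event reduces
  -- to the support and `K` cancels.
  have hzero : ∀ x ≤ t.2 0, x ∉ hyperSupport t → hyperWeight t w x = 0 := by
    intro x hx hx'
    simp only [hyperSupport, Finset.mem_Icc, le_min_iff, not_and_or, not_le] at hx'
    rcases hx' with h | h | h
    · simp [hyperWeight, Nat.choose_eq_zero_of_lt (show t.1 1 < t.2 0 - x by omega)]
    · simp [hyperWeight, Nat.choose_eq_zero_of_lt h]
    · omega
  have hsub : hyperSupport t ⊆ Finset.range (t.2 0 + 1) := by
    intro x hx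
    simp only [hyperSupport, Finset.mem_Icc, le_min_iff] at hx
    simp only [Finset.mem_range]
    omega
  have htotal : twoBinomial t θ₁ θ₂ s =
      ENNReal.ofReal (K * ∑ k ∈ hyperSupport t, hyperWeight t w k) := by
    have hs' : s = ((Finset.range (t.2 0 + 1)).image fun x => (x, t.2 0 - x) :
        Finset (ℕ × ℕ)) := by
      ext ⟨a, b⟩
      simp only [hs_def, Set.mem_ofPred_eq, Finset.coe_image, Set.mem_image, Finset.coe_range,
        Set.mem_Iio, Prod.mk.injEq]
      constructor
      · intro h
        exact ⟨a, by omega, rfl, by omega⟩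
      · rintro ⟨x, hx, rfl, rfl⟩
        omega
    rw [hs', ← sum_measure_singleton, Finset.sum_image (by simp +contextual [Set.InjOn]),
      Finset.mul_sum]
    rw [Finset.sum_congr rfl fun x hx => hmass x (by simpa [Nat.lt_succ_iff] using hx),
      ← Finset.sum_subset hsub fun x hx hx' => by
        rw [hzero x (by simpa [Nat.lt_succ_iff] using hx) hx']; simp]
    rw [ENNReal.ofReal_sum_of_nonneg]
    intro k hk
    exact mul_nonneg hK.le (hyperWeight_pos hw hk).le
  refine Measure.ext_of_singleton fun x => ?_
  rw [conditionalLaw, Measure.map_apply measurable_fst (by simp), cond_apply hs, htotal,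
    hyperLaw_singleton]
  rcases le_or_gt x (t.2 0) with hx | hx
  · have : s ∩ Prod.fst ⁻¹' {x} = {(x, t.2 0 - x)} := by
      ext ⟨a, b⟩
      simp only [hs_def, Set.mem_inter_iff, Set.mem_ofPred_eq, Set.mem_preimage,
        Set.mem_singleton_iff, Prod.mk.injEq]
      omega
    rw [this, hmass x hx]
    split_ifs with hmem
    · have hpos := sum_hyperWeight_pos ht hw
      rw [← ENNReal.ofReal_inv_of_pos (by positivity), ← ENNReal.ofReal_mul (by positivity),
        hyperMass]
      congr 1
      field_simp
    · rw [hzero x hx hmem]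
      simp
  · have : s ∩ Prod.fst ⁻¹' {x} = ∅ := by
      ext ⟨a, b⟩
      simp only [hs_def, Set.mem_inter_iff, Set.mem_ofPred_eq, Set.mem_preimage,
        Set.mem_singleton_iff, Set.mem_empty_iff_false, iff_false]
      omega
    rw [this, if_neg fun hmem => by have := Finset.mem_range.1 (hsub hmem); omega]
    simp

/-! ### The uniformly most powerful test and the `p`-value -/

section Test

variable {f : ℝ → ℝ} {ν : Measure ℝ} {t : Margins}

lemma tableOf_zero_zero (t : Margins) (h : ℕ) : tableOf t h 0 0 = h := rfl

lemma pValue_eq_sum (t : Margins) (ν : Measure ℝ) (u : ℝ) :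
    pValue t ν u = ∑ k ∈ hyperSupport t, hyperMass t 1 k * cdf ν ((k : ℝ) - u) :=
  integral_hyperLaw t one_pos _

lemma antitone_pValue (t : Margins) (ν : Measure ℝ) : Antitone (pValue t ν) := by
  intro u v huv
  rw [pValue_eq_sum, pValue_eq_sum]
  exact Finset.sum_le_sum fun k hk => mul_le_mul_of_nonneg_left
    (monotone_cdf ν (by linarith)) (hyperMass_pos one_pos hk).le

lemma IsCND.continuous_pValue (hν : IsCND f ν) (t : Margins) : Continuous (pValue t ν) := by
  have h : pValue t ν =
      fun u => ∑ k ∈ hyperSupport t, hyperMass t 1 k * cdf ν ((k : ℝ) - u) :=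
    funext (pValue_eq_sum t ν)
  rw [h]
  exact continuous_finsetSum _ fun k _ =>
    continuous_const.mul (hν.continuous.comp (by fun_prop))

lemma tendsto_pValue_atTop (t : Margins) (ν : Measure ℝ) :
    Filter.Tendsto (pValue t ν) Filter.atTop (nhds 0) := by
  have h : pValue t ν =
      fun u => ∑ k ∈ hyperSupport t, hyperMass t 1 k * cdf ν ((k : ℝ) - u) :=
    funext (pValue_eq_sum t ν)
  rw [h]
  have : Filter.Tendsto
      (fun u : ℝ => ∑ k ∈ hyperSupport t, hyperMass t 1 k * cdf ν ((k : ℝ) - u))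
      Filter.atTop (nhds (∑ k ∈ hyperSupport t, hyperMass t 1 k * 0)) :=
    tendsto_finsetSum _ fun k _ => ((tendsto_cdf_atBot ν).comp
      (Filter.tendsto_atBot_add_const_left _ (k : ℝ) Filter.tendsto_neg_atTop_atBot)).const_mul _
  simpa using this

lemma tendsto_pValue_atBot (ht : Feasible t) (ν : Measure ℝ) :
    Filter.Tendsto (pValue t ν) Filter.atBot (nhds 1) := by
  have h : pValue t ν =
      fun u => ∑ k ∈ hyperSupport t, hyperMass t 1 k * cdf ν ((k : ℝ) - u) :=
    funext (pValue_eq_sum t ν)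
  rw [h]
  have : Filter.Tendsto
      (fun u : ℝ => ∑ k ∈ hyperSupport t, hyperMass t 1 k * cdf ν ((k : ℝ) - u))
      Filter.atBot (nhds (∑ k ∈ hyperSupport t, hyperMass t 1 k * 1)) :=
    tendsto_finsetSum _ fun k _ => ((tendsto_cdf_atTop ν).comp
      (Filter.tendsto_atTop_add_const_left _ (k : ℝ) Filter.tendsto_neg_atBot_atTop)).const_mul _
  simpa [sum_hyperMass ht one_pos] using this

/-- The null power of the noise test is definitionally `pValue t ν m`, which runs continuously from
`1` to `0`. -/
lemma IsCND.exists_power_eq (hν : IsCND f ν) (ht : Feasible t) {α : ℝ}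
    (hα : α ∈ Set.Ioo (0 : ℝ) 1) : ∃ m, power t (noiseTest ν m) 1 = α := by
  obtain ⟨a, ha⟩ := ((tendsto_pValue_atTop t ν).eventually (eventually_le_nhds hα.1)).exists
  obtain ⟨b, hb⟩ := ((tendsto_pValue_atBot ht ν).eventually (eventually_ge_nhds hα.2)).exists
  obtain ⟨m, hm⟩ := mem_range_of_exists_le_of_exists_ge (hν.continuous_pValue t) ⟨a, ha⟩ ⟨b, hb⟩
  exact ⟨m, hm⟩

/-- Once a DP test falls below the noise test, it stays below. -/
lemma IsCND.test_succ_le (hf : IsTradeoffFunction f) (hν : IsCND f ν) {n : ℕ}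
    {Xstar : Database n} (h0 : Xstar ∈ conforming n t) {φ : TableTest}
    (hφ : IsSemiDP t f (testMechanism n φ)) {m : ℝ} {x : ℕ} (hx : x ∈ hyperSupport t)
    (hx1 : x + 1 ∈ hyperSupport t) (hpos : 0 < cdf ν ((x : ℝ) - m))
    (hle : (φ (tableOf t x) : ℝ) ≤ cdf ν ((x : ℝ) - m)) :
    (φ (tableOf t (x + 1)) : ℝ) ≤ cdf ν (((x + 1 : ℕ) : ℝ) - m) := by
  rcases (cdf_le_one ν ((x : ℝ) - m)).eq_or_lt with h1 | h1
  · refine (φ (tableOf t (x + 1))).2.2.trans ?_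
    rw [← h1]
    exact monotone_cdf ν (by push_cast; linarith)
  obtain ⟨X, hX, Y, hY, hA, hXx, hYx⟩ := exists_adjacent h0 hx hx1
  have h2 := hφ.test_le hX hY hA
  rw [table_eq_tableOf hX, table_eq_tableOf hY, hXx, hYx] at h2
  have hs := hν.symm (m - x)
  rw [neg_sub] at hs
  -- With `c = m - x`, the chain is `1 - F(x + 1 - m) = F(c - 1) ≤ f (F c) ≤ f (1 - φ(x)) ≤ 1 - φ(x
  -- + 1)`.
  have h3 := hν.cdf_sub_one_le hf (c := m - x) (by linarith) (by linarith)
  have hφ01 := (φ (tableOf t x)).2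
  have h4 : f (cdf ν (m - x)) ≤ f (1 - φ (tableOf t x)) :=
    hf.monotone ⟨by linarith, by linarith⟩ ⟨by linarith [hφ01.2], by linarith [hφ01.1]⟩
      (by linarith)
  have h5 := hν.symm (((x + 1 : ℕ) : ℝ) - m)
  rw [show -(((x + 1 : ℕ) : ℝ) - m) = m - x - 1 by push_cast; ring] at h5
  linarith

/-- A DP test crosses the noise test at most once, from above. -/
lemma IsCND.exists_crossing (hf : IsTradeoffFunction f) (hν : IsCND f ν) {n : ℕ}
    {Xstar : Database n} (h0 : Xstar ∈ conforming n t) {φ : TableTest}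
    (hφ : IsSemiDP t f (testMechanism n φ)) (m : ℝ) :
    ∃ x₀ : ℕ, ∀ k ∈ hyperSupport t,
      (k < x₀ → cdf ν ((k : ℝ) - m) ≤ φ (tableOf t k)) ∧
        (x₀ ≤ k → (φ (tableOf t k) : ℝ) ≤ cdf ν ((k : ℝ) - m)) := by
  classical
  -- Positivity is required because `test_succ_le` needs it to propagate. Points where `F` vanishes
  -- can be left of the crossing, since there `F = 0 ≤ φ`.
  by_cases h : ∃ k, k ∈ hyperSupport t ∧ 0 < cdf ν ((k : ℝ) - m) ∧
      (φ (tableOf t k) : ℝ) ≤ cdf ν ((k : ℝ) - m)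
  · obtain ⟨x₀, ⟨hs, hp, hl⟩, hmin⟩ : ∃ x₀, (x₀ ∈ hyperSupport t ∧ 0 < cdf ν ((x₀ : ℝ) - m) ∧
        (φ (tableOf t x₀) : ℝ) ≤ cdf ν ((x₀ : ℝ) - m)) ∧ ∀ k < x₀, ¬ (k ∈ hyperSupport t ∧
          0 < cdf ν ((k : ℝ) - m) ∧ (φ (tableOf t k) : ℝ) ≤ cdf ν ((k : ℝ) - m)) :=
      ⟨Nat.find h, Nat.find_spec h, fun _ => Nat.find_min h⟩
    refine ⟨x₀, fun k hk => ⟨fun hlt => ?_, fun hle => ?_⟩⟩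
    · rcases (cdf_nonneg ν ((k : ℝ) - m)).eq_or_lt with h' | h'
      · rw [← h']
        exact (φ (tableOf t k)).2.1
      · exact (not_le.1 fun hle => hmin k hlt ⟨hk, h', hle⟩).le
    · suffices 0 < cdf ν ((k : ℝ) - m) ∧ (φ (tableOf t k) : ℝ) ≤ cdf ν ((k : ℝ) - m) from this.2
      induction k, hle using Nat.le_induction with
      | base => exact ⟨hp, hl⟩
      | succ k hle ih =>
        have hk' : k ∈ hyperSupport t := by
          simp only [hyperSupport, Finset.mem_Icc] at hs hk ⊢
          omega
        obtain ⟨hp', hl'⟩ := ih hk'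
        exact ⟨hp'.trans_le (monotone_cdf ν (by push_cast; linarith)),
          hν.test_succ_le hf h0 hφ hk' hk hp' hl'⟩
  · push Not at h
    refine ⟨(hyperSupport t).sup id + 1, fun k hk => ⟨fun _ => ?_, fun hle => ?_⟩⟩
    · rcases (cdf_nonneg ν ((k : ℝ) - m)).eq_or_lt with h' | h'
      · rw [← h']
        exact (φ (tableOf t k)).2.1
      · exact (h k hk h').le
    · have : k ≤ (hyperSupport t).sup id := Finset.le_sup (f := id) hk
      omega

theorem IsCND.isUMP_noiseTest [IsProbabilityMeasure ν] (hf : IsTradeoffFunction f)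
    (hν : IsCND f ν) {n : ℕ} {Xstar : Database n} (h0 : Xstar ∈ conforming n t) {α m : ℝ}
    (hm : power t (noiseTest ν m) 1 = α) :
    IsUMP t (semiDPTests n t f α) (Set.Ioc 0 1) (Set.Ioi 1) α (noiseTest ν m) := by
  have ht : Feasible t := ⟨_, table_mem_hyperSupport h0⟩
  refine ⟨⟨isSemiDP_noiseTest hν n t m, hm⟩, IsGreatest.isLUB ⟨⟨1, by simp, hm⟩, ?_⟩, ?_⟩
  · rintro _ ⟨w, hw, rfl⟩
    rw [← hm]
    exact integral_hyperLaw_le_of_monotone ht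
      (fun a b hab => monotone_cdf ν (by
        simpa [tableOf_zero_zero] using hab)) hw.1 hw.2
  · rintro φ ⟨hφ, hφα⟩ w hw
    obtain ⟨x₀, hx₀⟩ := hν.exists_crossing hf h0 hφ m
    exact (integral_hyperLaw_of_crossing x₀ (fun k hk => (hx₀ k hk).1)
      (fun k hk => (hx₀ k hk).2) (hφα.trans hm.symm) (one_pos.trans hw)).1 (le_of_lt hw)

/-- Sublevel sets of the `p`-value are half-lines. -/
lemma IsCND.exists_pValue_le_iff (hν : IsCND f ν) (ht : Feasible t) {a : ℝ} (ha : a < 1)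
    (hne : ∃ u, pValue t ν u ≤ a) :
    ∃ u₀, pValue t ν u₀ ≤ a ∧ {u | pValue t ν u ≤ a} = Set.Ici u₀ := by
  set S := {u | pValue t ν u ≤ a} with hS
  have hclosed : IsClosed S := isClosed_le (hν.continuous_pValue t) continuous_const
  have hbdd : BddBelow S := by
    obtain ⟨b, hb⟩ := ((tendsto_pValue_atBot ht ν).eventually (eventually_gt_nhds ha)).exists
    refine ⟨b, fun u hu => ?_⟩
    by_contra hlt
    exact absurd (hb.trans_le (antitone_pValue t ν (not_le.1 hlt).le)) (not_lt.2 hu)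
  have hmem : sInf S ∈ S := hclosed.csInf_mem hne hbdd
  refine ⟨sInf S, hmem, Set.Subset.antisymm (fun u hu => csInf_le hbdd hu) fun u hu => ?_⟩
  exact (antitone_pValue t ν hu).trans hmem

variable [IsProbabilityMeasure ν]

lemma hyperLaw_prod_apply {w : ℝ} {s : Set (ℕ × ℝ)} (hs : MeasurableSet s) :
    ((hyperLaw t w).prod ν) s =
      ∑ k ∈ hyperSupport t, ENNReal.ofReal (hyperMass t w k) * ν (Prod.mk k ⁻¹' s) := by
  have : SFinite (hyperLaw t w) := by
    unfold hyperLaw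
    infer_instance
  rw [Measure.prod_apply hs]
  simp only [hyperLaw, lintegral_finsetSum_measure, lintegral_smul_measure, lintegral_dirac,
    smul_eq_mul, hyperMass]

lemma hyperLaw_prod_apply_eq_ofReal {w : ℝ} (hw : 0 < w) {s : Set (ℕ × ℝ)}
    (hs : MeasurableSet s) :
    ((hyperLaw t w).prod ν) s =
      ENNReal.ofReal (∫ k, ν.real (Prod.mk k ⁻¹' s) ∂(hyperLaw t w)) := by
  rw [hyperLaw_prod_apply hs, integral_hyperLaw t hw,
    ENNReal.ofReal_sum_of_nonneg fun k hk =>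
      mul_nonneg (hyperMass_pos hw hk).le measureReal_nonneg]
  refine Finset.sum_congr rfl fun k hk => ?_
  rw [ENNReal.ofReal_mul (hyperMass_pos hw hk).le, ofReal_measureReal]

lemma IsCND.measureReal_shift_Ici (hν : IsCND f ν) (x u : ℝ) :
    ν.real {z | u ≤ x + z} = cdf ν (x - u) := by
  have : {z | u ≤ x + z} = Set.Ici (u - x) := by
    ext z
    simp [add_comm]
  rw [this, measureReal_def, hν.measure_Ici, neg_sub, ENNReal.toReal_ofReal (cdf_nonneg ν _)]

theorem IsCND.prob_pValue_le (hν : IsCND f ν) (ht : Feasible t) {w : ℝ}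
    (hw : w ∈ Set.Ioc (0 : ℝ) 1) {a : ℝ} (ha0 : 0 ≤ a) (ha : a ≤ 1) :
    ((hyperLaw t w).prod ν) {q | pValue t ν ((q.1 : ℝ) + q.2) ≤ a} ≤ ENNReal.ofReal a := by
  have hmeas : MeasurableSet {q : ℕ × ℝ | pValue t ν ((q.1 : ℝ) + q.2) ≤ a} := by
    refine measurableSet_le ((hν.continuous_pValue t).measurable.comp ?_) measurable_const
    exact ((measurable_from_nat (f := fun k : ℕ => (k : ℝ))).comp measurable_fst).add
      measurable_snd
  rw [hyperLaw_prod_apply_eq_ofReal hw.1 hmeas]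
  refine ENNReal.ofReal_le_ofReal ?_
  refine (integral_hyperLaw_le_of_monotone ht ?_ hw.1 hw.2).trans ?_
  · intro j k hjk
    refine measureReal_mono fun z hz => (antitone_pValue t ν ?_).trans hz
    have : (j : ℝ) ≤ k := by exact_mod_cast hjk
    simp only
    linarith
  -- At `a = 1` the sublevel set is the whole line, not a half-line.
  · rcases ha.eq_or_lt with rfl | ha
    · rw [integral_hyperLaw t one_pos]
      refine le_trans ?_ (sum_hyperMass ht one_pos).le
      exact Finset.sum_le_sum fun k hk =>
        mul_le_of_le_one_right (hyperMass_pos one_pos hk).le measureReal_le_one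
    · by_cases hne : ∃ u, pValue t ν u ≤ a
      · obtain ⟨u₀, hu₀, hS⟩ := hν.exists_pValue_le_iff ht ha hne
        refine le_trans (le_of_eq ?_) hu₀
        refine integral_congr_ae (.of_forall fun k => ?_)
        beta_reduce
        rw [← hν.measureReal_shift_Ici]
        refine congrArg ν.real (Set.ext fun z => ?_)
        exact Set.ext_iff.1 hS ((k : ℝ) + z)
      · have hempty : ∀ k : ℕ,
            Prod.mk k ⁻¹' {q : ℕ × ℝ | pValue t ν ((q.1 : ℝ) + q.2) ≤ a} = ∅ :=
          fun k => Set.eq_empty_of_forall_notMem fun z hz => hne ⟨_, hz⟩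
        simpa [hempty] using ha0

/-- The `p`-value may be constant just left of `m`, so the rejection threshold `u₀` can be smaller
than `m`. Equality of the two weighted sums of ordered terms, with positive weights, forces `F(k -
u₀) = F(k - m)` at every `k` in the support. -/
theorem IsCND.noisyCount_pValue_le (hν : IsCND f ν) {n : ℕ} {α m : ℝ} (hα : α < 1)
    (hm : power t (noiseTest ν m) 1 = α) {X : Database n} (hX : X ∈ conforming n t) :
    noisyCount n ν X {u | pValue t ν u ≤ α} =
      ENNReal.ofReal (noiseTest ν m (table X) : ℝ) := by
  have hmem := table_mem_hyperSupport hX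
  have hm' : pValue t ν m = α := hm
  obtain ⟨u₀, hu₀, hS⟩ := hν.exists_pValue_le_iff ⟨_, hmem⟩ hα ⟨m, hm'.le⟩
  have hle : u₀ ≤ m := (Set.ext_iff.1 hS m).1 hm'.le
  have heq : pValue t ν m = pValue t ν u₀ :=
    le_antisymm (antitone_pValue t ν hle) (hu₀.trans hm'.ge)
  rw [pValue_eq_sum, pValue_eq_sum] at heq
  have h := (Finset.sum_eq_sum_iff_of_le fun k hk => mul_le_mul_of_nonneg_left
    (monotone_cdf ν (by linarith)) (hyperMass_pos one_pos hk).le).1 heq _ hmem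
  have h' := mul_left_cancel₀ (hyperMass_pos one_pos hmem).ne' h
  rw [hS, hν.noisyCount_Ici, ← h']
  rfl

end Test

end SemiDP

theorem mainTheorem3 {n : ℕ} (Xstar : SemiDP.Database n) (t : SemiDP.Margins)
    (ht : SemiDP.margins Xstar = t)
    (f : ℝ → ℝ) (hf : SemiDP.IsTradeoffFunction f) (hf_symm : SemiDP.IsSymmetricTradeoff f)
    (hf_nontriv : SemiDP.IsNontrivialTradeoff f)
    (ν : Measure ℝ) [IsProbabilityMeasure ν] (hν : SemiDP.IsCND f ν)
    (α : ℝ) (hα : α ∈ Set.Ioo (0 : ℝ) 1) :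
    -- given the margins, the count `x₁₁` has the hypergeometric law with the odds ratio
    (∀ θ₁ θ₂ : unitInterval, 0 < θ₁ → θ₁ < 1 → 0 < θ₂ → θ₂ < 1 →
      SemiDP.conditionalLaw t θ₁ θ₂ = SemiDP.hyperLaw t (SemiDP.oddsRatio θ₁ θ₂)) ∧
    -- `m(t)` exists, and every choice of it gives the UMP test
    (∃ m : ℝ, SemiDP.power t (SemiDP.noiseTest ν m) 1 = α) ∧
    (∀ m : ℝ, SemiDP.power t (SemiDP.noiseTest ν m) 1 = α →
      SemiDP.IsUMP t (SemiDP.semiDPTests n t f α) (Set.Ioc 0 1) (Set.Ioi 1) α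
        (SemiDP.noiseTest ν m)) ∧
    -- `U = x₁₁ + N` is `(D_t, A_{a(t)}, f)`-DP
    SemiDP.IsSemiDP t f (SemiDP.noisyCount n ν) ∧
    -- `p` is a (measurable) function of `U` and the invariant
    Measurable (SemiDP.pValue t ν) ∧
    -- `p` is a p-value: under `H₀`, `ℙ(p ≤ a) ≤ a`
    (∀ w ∈ Set.Ioc (0 : ℝ) 1, ∀ a ∈ Set.Icc (0 : ℝ) 1,
      ((SemiDP.hyperLaw t w).prod ν) {q | SemiDP.pValue t ν ((q.1 : ℝ) + q.2) ≤ a}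
        ≤ ENNReal.ofReal a) ∧
    -- `p` agrees with the UMP test: `ℙ(p ≤ α | X) = φ*(X)`
    (∀ m : ℝ, SemiDP.power t (SemiDP.noiseTest ν m) 1 = α →
      ∀ X ∈ SemiDP.conforming n t,
        SemiDP.noisyCount n ν X {u | SemiDP.pValue t ν u ≤ α} =
          ENNReal.ofReal (SemiDP.noiseTest ν m (SemiDP.table X) : ℝ)) := by
  have h0 : Xstar ∈ SemiDP.conforming n t := ht
  have hfeas : SemiDP.Feasible t := ⟨_, SemiDP.table_mem_hyperSupport h0⟩
  exact ⟨fun _ _ h1 h1' h2 h2' => SemiDP.conditionalLaw_eq_hyperLaw hfeas h1 h1' h2 h2',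
    hν.exists_power_eq hfeas hα, fun _ hm => hν.isUMP_noiseTest hf h0 hm,
    SemiDP.isSemiDP_noisyCount hν n t, (hν.continuous_pValue t).measurable,
    fun _ hw _ ha => hν.prob_pValue_le hfeas hw ha.1 ha.2,
    fun _ hm _ hX => hν.noisyCount_pValue_le hα.2 hm hX⟩
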